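/- Let $0<\gamma<1$ and $\theta\in\mathbb R$, and consider the three-slit domain $$U=\mathbb C\setminus\bigl(\mathbb R_{\ge 1}e^{i\theta}\cup\mathbb R_{\ge 1}e^{i(\theta+\pi\gamma)}\cup\mathbb R_{\ge 1}e^{i(\theta+2\pi-\pi\gamma)}\bigr),$$ whose slits are separated by the angles $\pi\gamma_1,\pi\gamma_2,\pi\gamma_3$ with $\gamma_1=\gamma_3=\gamma$ and $\gamma_2=2-2\gamma$. There is a unique conformal isomorphism $\phi_+$ from the open unit disk $\Delta$ onto $U$ with $\phi_+(0)=0$ and $\phi_+'(0)>0$; its derivative $\rho_0=\phi_+'(0)$ is the conformal radius of $U$ with respect to $0$. The function $y=\frac{(1-x)^{\gamma}}{1+x}$ decreases strictly from $1$ to $0$ as $x$ increases from $0$ to $1$, hence it is a bijection of $[0,1]$ onto itself and has an inverse $x=x(y)$ there. Moreover $0<2^{\gamma-1}\gamma^{\gamma}(1-\gamma)^{1-\gamma}<1$. Put $$x=x\bigl(2^{\gamma-1}\gamma^{\gamma}(1-\gamma)^{1-\gamma}\bigr).$$ Then $$\rho_0=2(1+x)\gamma^{\gamma}(1-\gamma)^{1-\gamma}.$$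 Furthermore $x=\cos t$, where $t=\arccos x$ is the angle of the accessory parameter: for all $z\in\Delta$, with principal powers, $$\phi_+(z)=\rho_0\,z\,\Bigl(1-\frac{z}{e^{i(\theta+t)}}\Bigr)^{-\gamma}\Bigl(1+\frac{z}{e^{i\theta}}\Bigr)^{-(2-2\gamma)}\Bigl(1-\frac{z}{e^{i(\theta-t)}}\Bigr)^{-\gamma}.$$ -/

import Mathlib

/-- The slit domain: the complex plane with the rays `{r e^{i φ j} : 1 ≤ r}` removed. -/
def slitDomain {m : ℕ} (φ : Fin m → ℝ) : Set ℂ :=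
  {w | ∀ j : Fin m, ∀ r : ℝ, 1 ≤ r → w ≠ (r : ℂ) * Complex.exp ((φ j : ℂ) * Complex.I)}

/-- `f` restricts to a conformal isomorphism of the open unit disk onto `V` (a holomorphic
bijection; its inverse is then holomorphic as well), with `f 0 = 0` and `f' 0` a positive real. -/
structure IsNormalizedRiemannMap (f : ℂ → ℂ) (V : Set ℂ) : Prop where
  differentiableOn : DifferentiableOn ℂ f (Metric.ball 0 1)
  bijOn : Set.BijOn f (Metric.ball 0 1) V
  map_zero : f 0 = 0
  deriv_re_pos : 0 < (deriv f 0).re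
  deriv_im_zero : (deriv f 0).im = 0

/-- The conformal radius of `V` with respect to `0`: the derivative at `0` of the normalized
conformal isomorphism from the unit disk onto `V`. It is meaningful for those `V` for which such an
isomorphism exists; by the Schwarz lemma, it is then unique on the unit disk. -/
noncomputable def conformalRadius (V : Set ℂ) : ℝ :=
  (deriv (Classical.epsilon fun f : ℂ → ℂ => IsNormalizedRiemannMap f V) 0).re

/-- The angles `θ, θ + πγ, θ + 2π - πγ`. The consecutive gaps, divided by `π`, are
`γ, 2 - 2γ, γ`. The slit domain with these angles is the three-slit domain, rotated by `θ`. -/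
noncomputable def threeSlitAngles (γ θ : ℝ) : Fin 3 → ℝ :=
  ![θ, θ + Real.pi * γ, θ + (2 * Real.pi - Real.pi * γ)]

/-- The function `y = (1 - x)^γ / (1 + x)`. -/
noncomputable def slitY (γ x : ℝ) : ℝ := (1 - x) ^ γ / (1 + x)

/-- The inverse `x = x(y)` of `y = (1 - x)^γ / (1 + x)` on the interval `0 ≤ x ≤ 1`. -/
noncomputable def slitX (γ : ℝ) : ℝ → ℝ := Function.invFunOn (slitY γ) (Set.Icc 0 1)

/-- The number `2^(γ-1) γ^γ (1-γ)^(1-γ)`. -/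
noncomputable def slitValue (γ : ℝ) : ℝ := 2 ^ (γ - 1) * γ ^ γ * (1 - γ) ^ (1 - γ)

/-! The candidate map is f(z) = ρ z / ∏ (1 - a_j z)^(w_j) with |a_j| = 1, w_j > 0 and Σ w_j = 2;
what must be shown is that it is a bijection onto the slit domain and that no other normalized map
exists.

Injectivity is starlikeness. In the variable s = log z, a logarithm of f/ρ has derivative Σ w_j (1/2
+ a_j z/(1 - a_j z)), whose real part is positive, so Noshiro-Warschawski applies on the convex
half-plane Re s < 0. One endpoint may lie on the boundary, so interior values also differ from
finite boundary values (`eq_of_div_slitProd_eq`). Once the finite boundary values are exactly the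
slits, connectedness of the domain gives surjectivity (`bijOn_div_slitProd`).

For the boundary values put u = e^(-iθ) z with |u| = 1 and c = Re u. The argument of f is constant
on each arc between prevertices, and |f| = ρ / `slitModulus γ x c`. The modulus has one maximum for
c > x, at c = 1, and one for c < x, given by weighted AM-GM. All slits start at distance 1 exactly
when both maxima equal ρ; the second gives the formula for ρ, and equality of the two is the
equation y(x) = `slitValue γ`.

Uniqueness comes from the Schwarz lemma (`IsNormalizedRiemannMap.eqOn`), and it makes the chosen map
in `conformalRadius` computable. -/

/-- The product `∏ (1 - a j z) ^ w j`, with principal powers. -/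
noncomputable def slitProd {ι : Type*} [Fintype ι] (a : ι → ℂ) (w : ι → ℝ) (z : ℂ) : ℂ :=
  ∏ j, (1 - a j * z) ^ (w j : ℂ)

/-- A logarithm of `z / slitProd a w z` in the variable `log z`. -/
noncomputable def slitLog {ι : Type*} [Fintype ι] (a : ι → ℂ) (w : ι → ℝ) (s : ℂ) : ℂ :=
  s - ∑ j, (w j : ℂ) * Complex.log (1 - a j * Complex.exp s)

/-! ### Univalence and image of z / ∏ (1 - a_j z)^(w_j). -/

section SlitProd

open Complex Metric Set Filter Topology

/-- Noshiro-Warschawski on a segment: a function whose derivative has positive real part inside the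
segment takes different values at its endpoints. -/
theorem ne_of_hasDerivAt_re_pos_on_segment {F F' : ℂ → ℂ} {p q : ℂ} (hpq : p ≠ q)
    (hc : ∀ r ∈ Icc (0 : ℝ) 1, ContinuousAt F (p + r * (q - p)))
    (hd : ∀ r ∈ Ioo (0 : ℝ) 1, HasDerivAt F (F' (p + r * (q - p))) (p + r * (q - p)))
    (hpos : ∀ r ∈ Ioo (0 : ℝ) 1, 0 < (F' (p + r * (q - p))).re) : F p ≠ F q := by
  intro h
  have hne : q - p ≠ 0 := sub_ne_zero.2 hpq.symm
  -- Dividing by q - p cancels the chain-rule factor, so the derivative of g is exactly Re F', and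
  -- Rolle's theorem applies.
  let g : ℝ → ℝ := fun r => (F (p + r * (q - p)) / (q - p)).re
  have hcont : ContinuousOn g (Icc 0 1) := by
    intro r hr
    have h1 : ContinuousAt (fun r : ℝ => F (p + r * (q - p))) r :=
      ContinuousAt.comp (f := fun r : ℝ => p + (r : ℂ) * (q - p)) (hc r hr) (by fun_prop)
    exact (continuous_re.continuousAt.comp (h1.div_const _)).continuousWithinAt
  have hder : ∀ r ∈ Ioo (0 : ℝ) 1, HasDerivAt g (F' (p + r * (q - p))).re r := by
    intro r hr
    have h1 : HasDerivAt (fun u : ℂ => p + u * (q - p)) (q - p) (r : ℂ) := by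
      simpa using ((hasDerivAt_id (r : ℂ)).mul_const (q - p)).const_add p
    have h2 := (HasDerivAt.comp (r : ℂ) (hd r hr) h1).div_const (q - p)
    rw [mul_div_cancel_right₀ _ hne] at h2
    exact h2.real_of_complex
  obtain ⟨r, hr, h0⟩ := exists_hasDerivAt_eq_zero one_pos hcont (by simp [g, h]) hder
  exact (hpos r hr).ne' h0

theorem one_sub_mul_re_pos {a z : ℂ} (ha : ‖a‖ = 1) (hz : ‖z‖ < 1) : 0 < (1 - a * z).re := by
  have h1 : (a * z).re ≤ ‖a * z‖ := re_le_norm _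
  rw [norm_mul, ha, one_mul] at h1
  simp only [sub_re, one_re]
  linarith

theorem one_sub_mul_re_nonneg {a z : ℂ} (ha : ‖a‖ = 1) (hz : ‖z‖ ≤ 1) : 0 ≤ (1 - a * z).re := by
  have h1 : (a * z).re ≤ ‖a * z‖ := re_le_norm _
  rw [norm_mul, ha, one_mul] at h1
  simp only [sub_re, one_re]
  linarith

theorem one_sub_mul_re_pos_of_ne {a z : ℂ} (ha : ‖a‖ = 1) (hz : ‖z‖ ≤ 1) (h : 1 - a * z ≠ 0) :
    0 < (1 - a * z).re := by
  refine (one_sub_mul_re_nonneg ha hz).lt_of_ne fun h0 => h ?_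
  have h1 : ‖a * z‖ ≤ 1 := by rw [norm_mul, ha, one_mul]; exact hz
  have h2 := Complex.sq_norm_sub_sq_re (a * z)
  have h3 : (a * z).re = 1 := by simp only [sub_re, one_re] at h0; linarith
  have h4 : (a * z).im = 0 := by
    rw [h3] at h2
    nlinarith [norm_nonneg (a * z), sq_nonneg (a * z).im]
  apply Complex.ext
  · exact h0.symm
  · simp [h4]

/-- The expression is half the Cayley transform (1 + u)/(1 - u), which sends the disk to the right
half-plane. -/
theorem re_half_add_div_one_sub_pos {u : ℂ} (hu : ‖u‖ < 1) : 0 < (1 / 2 + u / (1 - u)).re := by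
  have hne : 1 - u ≠ 0 := by
    intro h
    rw [← sub_eq_zero.1 h] at hu
    simp at hu
  have hn : 0 < normSq (1 - u) := normSq_pos.2 hne
  have h1 : (1 / 2 + u / (1 - u)).re = (1 - normSq u) / (2 * normSq (1 - u)) := by
    rw [add_re, div_re u]
    field_simp
    simp [normSq_apply]
    ring
  rw [h1]
  have h2 : normSq u < 1 := by
    rw [normSq_eq_norm_sq]
    nlinarith [norm_nonneg u]
  exact div_pos (by linarith) (by linarith)

variable {ι : Type*} [Fintype ι] {a : ι → ℂ} {w : ι → ℝ}

theorem slitProd_ne_zero_iff (hw : ∀ j, 0 < w j) {z : ℂ} :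
    slitProd a w z ≠ 0 ↔ ∀ j, 1 - a j * z ≠ 0 := by
  simp only [slitProd, Finset.prod_ne_zero_iff, Finset.mem_univ, true_implies, ne_eq, cpow_eq_zero_iff,
    not_and_or, ofReal_eq_zero, not_not]
  exact forall_congr' fun j => ⟨fun h => h.resolve_right (hw j).ne', Or.inl⟩

theorem slitProd_ne_zero (ha : ∀ j, ‖a j‖ = 1) (hw : ∀ j, 0 < w j) {z : ℂ} (hz : ‖z‖ < 1) :
    slitProd a w z ≠ 0 :=
  (slitProd_ne_zero_iff hw).2 fun j h => by
    have := one_sub_mul_re_pos (ha j) hz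
    simp [h] at this

theorem slitProd_zero : slitProd a w 0 = 1 := by simp [slitProd]

theorem exp_slitLog_mul_slitProd (hw : ∀ j, 0 < w j) {s : ℂ} (hs : slitProd a w (exp s) ≠ 0) :
    exp (slitLog a w s) * slitProd a w (exp s) = exp s := by
  have h : slitProd a w (exp s) = exp (∑ j, (w j : ℂ) * log (1 - a j * exp s)) := by
    rw [exp_sum]
    refine Finset.prod_congr rfl fun j _ => ?_
    rw [cpow_def_of_ne_zero ((slitProd_ne_zero_iff hw).1 hs j), mul_comm]
  rw [h, ← exp_add, slitLog, sub_add_cancel]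

theorem continuousAt_slitLog (ha : ∀ j, ‖a j‖ = 1) (hw : ∀ j, 0 < w j) {s : ℂ} (hs : s.re ≤ 0)
    (hP : slitProd a w (exp s) ≠ 0) : ContinuousAt (slitLog a w) s := by
  unfold slitLog
  refine continuousAt_id.sub (tendsto_finsetSum _ fun j _ => ?_)
  refine continuousAt_const.mul (ContinuousAt.clog (by fun_prop) (Or.inl ?_))
  exact one_sub_mul_re_pos_of_ne (ha j) (by rw [norm_exp]; exact Real.exp_le_one_iff.2 hs)
    ((slitProd_ne_zero_iff hw).1 hP j)

/-- The derivative of `slitLog`. -/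
theorem hasDerivAt_slitLog (ha : ∀ j, ‖a j‖ = 1) {s : ℂ} (hs : s.re < 0) :
    HasDerivAt (slitLog a w) (1 + ∑ j, (w j : ℂ) * (a j * exp s / (1 - a j * exp s))) s := by
  have hn : ‖exp s‖ < 1 := by rw [norm_exp]; exact Real.exp_lt_one_iff.2 hs
  have h : HasDerivAt (slitLog a w)
      (1 - ∑ j, (w j : ℂ) * (-(a j * exp s) / (1 - a j * exp s))) s := by
    unfold slitLog
    refine (hasDerivAt_id s).sub (HasDerivAt.fun_sum fun j _ => HasDerivAt.const_mul _ ?_)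
    exact HasDerivAt.clog (((Complex.hasDerivAt_exp s).const_mul (a j)).const_sub 1)
      (Or.inl (one_sub_mul_re_pos (ha j) hn))
  convert h using 1
  rw [sub_eq_add_neg, ← Finset.sum_neg_distrib]
  congr 1
  refine Finset.sum_congr rfl fun j _ => ?_
  ring

/-- Total weight 2 lets the leading 1 be distributed as w_j/2 over the factors, each of which then
becomes a Cayley transform. -/
theorem re_deriv_slitLog_pos (ha : ∀ j, ‖a j‖ = 1) (hw : ∀ j, 0 < w j) (hsum : ∑ j, w j = 2)
    {s : ℂ} (hs : s.re < 0) :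
    0 < (1 + ∑ j, (w j : ℂ) * (a j * exp s / (1 - a j * exp s))).re := by
  have hn : ‖exp s‖ < 1 := by rw [norm_exp]; exact Real.exp_lt_one_iff.2 hs
  have h1 : 1 + ∑ j, (w j : ℂ) * (a j * exp s / (1 - a j * exp s)) =
      ∑ j, (w j : ℂ) * (1 / 2 + a j * exp s / (1 - a j * exp s)) := by
    simp only [mul_add, Finset.sum_add_distrib, ← Finset.sum_mul, ← ofReal_sum, hsum]
    norm_num
  have hne : (Finset.univ : Finset ι).Nonempty := by
    by_contra h
    rw [Finset.not_nonempty_iff_eq_empty] at h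
    simp [h] at hsum
  rw [h1, re_sum]
  refine Finset.sum_pos (fun j _ => ?_) hne
  rw [re_ofReal_mul]
  exact mul_pos (hw j) (re_half_add_div_one_sub_pos (by rw [norm_mul, ha j, one_mul]; exact hn))

theorem slitLog_add_int_mul (s : ℂ) (n : ℤ) :
    slitLog a w (s + n * (2 * Real.pi * I)) = slitLog a w s + n * (2 * Real.pi * I) := by
  have : exp (s + n * (2 * Real.pi * I)) = exp s := exp_eq_exp_iff_exists_int.2 ⟨n, rfl⟩
  simp only [slitLog, this]
  ring

/-- The two points play different roles: z₂ may lie on the unit circle, which also separates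
interior values from boundary values. -/
theorem eq_of_div_slitProd_eq (ha : ∀ j, ‖a j‖ = 1) (hw : ∀ j, 0 < w j) (hsum : ∑ j, w j = 2)
    {z₁ z₂ : ℂ} (h₁ : ‖z₁‖ < 1) (h₂ : ‖z₂‖ ≤ 1) (hP : slitProd a w z₂ ≠ 0)
    (h : z₁ / slitProd a w z₁ = z₂ / slitProd a w z₂) : z₁ = z₂ := by
  have hP₁ : slitProd a w z₁ ≠ 0 := slitProd_ne_zero ha hw h₁
  rcases eq_or_ne z₁ 0 with rfl | hz₁
  · rw [zero_div, eq_comm, div_eq_zero_iff] at h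
    exact (h.resolve_right hP).symm
  have hz₂ : z₂ ≠ 0 := by
    rintro rfl
    rw [zero_div, div_eq_zero_iff] at h
    tauto
  obtain ⟨s₁, rfl⟩ : ∃ s, exp s = z₁ := ⟨log z₁, exp_log hz₁⟩
  obtain ⟨s₂, rfl⟩ : ∃ s, exp s = z₂ := ⟨log z₂, exp_log hz₂⟩
  rw [← eq_div_iff hP₁ |>.2 (exp_slitLog_mul_slitProd hw hP₁),
    ← eq_div_iff hP |>.2 (exp_slitLog_mul_slitProd hw hP)] at h
  obtain ⟨n, hn⟩ := exp_eq_exp_iff_exists_int.1 h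
  -- The period 2πin is absorbed into the second logarithm s₂, so that `slitLog` takes equal values
  -- at two points.
  rw [← slitLog_add_int_mul] at hn
  have hexp : exp (s₂ + n * (2 * Real.pi * I)) = exp s₂ := exp_eq_exp_iff_exists_int.2 ⟨n, rfl⟩
  rw [← hexp] at h₂ hP ⊢
  set s₃ := s₂ + n * (2 * Real.pi * I)
  have hs₁ : s₁.re < 0 := by rwa [norm_exp, Real.exp_lt_one_iff] at h₁
  have hs₃ : s₃.re ≤ 0 := by rwa [norm_exp, Real.exp_le_one_iff] at h₂
  by_contra hne
  have hss : s₁ ≠ s₃ := fun e => hne (by rw [e])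
  have hre : ∀ r ∈ Ico (0 : ℝ) 1, (s₁ + r * (s₃ - s₁)).re < 0 := by
    intro r hr
    rw [add_re, re_ofReal_mul, sub_re]
    nlinarith [hr.1, hr.2]
  refine ne_of_hasDerivAt_re_pos_on_segment
    (F' := fun s => 1 + ∑ j, (w j : ℂ) * (a j * exp s / (1 - a j * exp s))) hss ?_
    (fun r hr => hasDerivAt_slitLog ha (hre r ⟨hr.1.le, hr.2⟩))
    (fun r hr => re_deriv_slitLog_pos ha hw hsum (hre r ⟨hr.1.le, hr.2⟩)) hn
  intro r hr
  rcases hr.2.lt_or_eq with h1 | rfl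
  · exact (hasDerivAt_slitLog ha (hre r ⟨hr.1, h1⟩)).continuousAt
  · have : s₁ + ((1 : ℝ) : ℂ) * (s₃ - s₁) = s₃ := by push_cast; ring
    rw [this]
    exact continuousAt_slitLog ha hw hs₃ hP

theorem differentiableAt_slitProd (ha : ∀ j, ‖a j‖ = 1) {z : ℂ} (hz : ‖z‖ < 1) :
    DifferentiableAt ℂ (slitProd a w) z := by
  unfold slitProd
  refine DifferentiableAt.fun_finsetProd fun j _ => ?_
  exact DifferentiableAt.cpow (by fun_prop) (by fun_prop) (Or.inl (one_sub_mul_re_pos (ha j) hz))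

theorem continuousAt_slitProd (ha : ∀ j, ‖a j‖ = 1) (hw : ∀ j, 0 < w j) {z : ℂ} (hz : ‖z‖ ≤ 1) :
    ContinuousAt (slitProd a w) z := by
  unfold slitProd
  refine tendsto_finsetProd _ fun j _ => ?_
  exact ContinuousAt.comp (f := fun z => 1 - a j * z) (continuousAt_cpow_const_of_re_pos
    (Or.inl (one_sub_mul_re_nonneg (ha j) hz)) (by simpa using hw j)) (by fun_prop)

theorem differentiableAt_div_slitProd (ha : ∀ j, ‖a j‖ = 1) (hw : ∀ j, 0 < w j) (ρ : ℂ) {z : ℂ}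
    (hz : ‖z‖ < 1) : DifferentiableAt ℂ (fun z => ρ * (z / slitProd a w z)) z :=
  (differentiableAt_id.div (differentiableAt_slitProd ha hz)
    (slitProd_ne_zero ha hw hz)).const_mul ρ

theorem deriv_div_slitProd_zero (ha : ∀ j, ‖a j‖ = 1) (ρ : ℂ) :
    deriv (fun z => ρ * (z / slitProd a w z)) 0 = ρ := by
  have h0 : slitProd a w 0 ≠ 0 := by simp [slitProd_zero]
  have h : HasDerivAt (slitProd a w) (deriv (slitProd a w) 0) 0 :=
    (differentiableAt_slitProd ha (by simp)).hasDerivAt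
  have := (((hasDerivAt_id (0 : ℂ)).fun_div h h0).const_mul ρ).deriv
  simpa [slitProd_zero] using this

theorem deriv_div_slitProd_ne_zero (ha : ∀ j, ‖a j‖ = 1) (hw : ∀ j, 0 < w j) (hsum : ∑ j, w j = 2)
    {ρ : ℂ} (hρ : ρ ≠ 0) {z : ℂ} (hz : ‖z‖ < 1) :
    deriv (fun z => ρ * (z / slitProd a w z)) z ≠ 0 := by
  rcases eq_or_ne z 0 with rfl | hz0
  · rwa [deriv_div_slitProd_zero ha]
  obtain ⟨s, rfl⟩ : ∃ s, exp s = z := ⟨log z, exp_log hz0⟩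
  have hs : s.re < 0 := by rwa [norm_exp, Real.exp_lt_one_iff] at hz
  have h1 := (differentiableAt_div_slitProd ha hw ρ hz).hasDerivAt.comp s (Complex.hasDerivAt_exp s)
  have h2 := (hasDerivAt_slitLog (w := w) ha hs).cexp.const_mul ρ
  have h3 : (fun z => ρ * (z / slitProd a w z)) ∘ exp =ᶠ[𝓝 s]
      fun s => ρ * exp (slitLog a w s) := by
    filter_upwards [continuous_re.continuousAt.eventually_lt continuousAt_const hs] with u hu
    have hP : slitProd a w (exp u) ≠ 0 :=
      slitProd_ne_zero ha hw (by rw [norm_exp]; exact Real.exp_lt_one_iff.2 hu)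
    simp only [Function.comp]
    congr 1
    rw [div_eq_iff hP, exp_slitLog_mul_slitProd hw hP]
  have h4 := h1.unique (h2.congr_of_eventuallyEq h3)
  intro h0
  rw [h0, zero_mul, eq_comm] at h4
  have h5 := re_deriv_slitLog_pos ha hw hsum hs
  have h6 : (1 + ∑ j, (w j : ℂ) * (a j * exp s / (1 - a j * exp s))) ≠ 0 := by
    intro h
    rw [h] at h5
    simp at h5
  exact mul_ne_zero hρ (mul_ne_zero (exp_ne_zero _) h6) h4

/-- By compactness the preimages subconverge to some z in the closed disk, and v P(z) = ρ z in the
limit, where P is the product. If P(z) = 0, this forces z = 0, where P = 1. -/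
theorem exists_eq_of_mem_closure_image (ha : ∀ j, ‖a j‖ = 1) (hw : ∀ j, 0 < w j)
    {ρ : ℂ} (hρ : ρ ≠ 0) {v : ℂ}
    (hv : v ∈ closure ((fun z => ρ * (z / slitProd a w z)) '' ball 0 1)) :
    ∃ z, ‖z‖ ≤ 1 ∧ slitProd a w z ≠ 0 ∧ ρ * (z / slitProd a w z) = v := by
  obtain ⟨u, hu, hlim⟩ := mem_closure_iff_seq_limit.1 hv
  choose y hy hyu using hu
  obtain ⟨z, hz, φ, hφ, hzlim⟩ := (isCompact_closedBall (0 : ℂ) 1).tendsto_subseq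
    fun n => ball_subset_closedBall (hy n)
  rw [mem_closedBall_zero_iff] at hz
  have h1 : Tendsto (fun n => u (φ n) * slitProd a w (y (φ n))) atTop (𝓝 (v * slitProd a w z)) :=
    (hlim.comp hφ.tendsto_atTop).mul ((continuousAt_slitProd ha hw hz).tendsto.comp hzlim)
  have h2 : Tendsto (fun n => ρ * y (φ n)) atTop (𝓝 (ρ * z)) := hzlim.const_mul ρ
  have h3 : v * slitProd a w z = ρ * z := by
    refine tendsto_nhds_unique (h1.congr fun n => ?_) h2
    have := slitProd_ne_zero ha hw (mem_ball_zero_iff.1 (hy (φ n)))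
    rw [← hyu]
    field_simp
  have hP : slitProd a w z ≠ 0 := by
    intro h
    rw [h, mul_zero, eq_comm, mul_eq_zero] at h3
    rw [h3.resolve_left hρ, slitProd_zero] at h
    exact one_ne_zero h
  exact ⟨z, hz, hP, by rw [← mul_div_assoc, ← h3, mul_div_cancel_right₀ _ hP]⟩

/-- If the boundary values of `ρ z / ∏ (1 - a j z) ^ w j` are exactly the points outside the domain
`V`, then this function maps the unit disk bijectively onto `V`. -/
theorem bijOn_div_slitProd (ha : ∀ j, ‖a j‖ = 1) (hw : ∀ j, 0 < w j) (hsum : ∑ j, w j = 2)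
    {ρ : ℂ} (hρ : ρ ≠ 0) {V : Set ℂ} (hV : IsPreconnected V) (h0 : 0 ∈ V)
    (hbd : ∀ z, ‖z‖ = 1 → slitProd a w z ≠ 0 → ρ * (z / slitProd a w z) ∉ V)
    (hcov : ∀ v ∉ V, ∃ z, ‖z‖ = 1 ∧ slitProd a w z ≠ 0 ∧ ρ * (z / slitProd a w z) = v) :
    BijOn (fun z => ρ * (z / slitProd a w z)) (ball 0 1) V := by
  set f := fun z => ρ * (z / slitProd a w z) with hf
  have key : ∀ z₁ z₂, ‖z₁‖ < 1 → ‖z₂‖ ≤ 1 → slitProd a w z₂ ≠ 0 → f z₁ = f z₂ → z₁ = z₂ :=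
    fun z₁ z₂ h₁ h₂ hP h => eq_of_div_slitProd_eq ha hw hsum h₁ h₂ hP (mul_left_cancel₀ hρ h)
  have hinj : InjOn f (ball 0 1) := fun z₁ h₁ z₂ h₂ h => by
    rw [mem_ball_zero_iff] at h₁ h₂
    exact key z₁ z₂ h₁ h₂.le (slitProd_ne_zero ha hw h₂) h
  have hmaps : MapsTo f (ball 0 1) V := by
    intro z hz
    by_contra hzV
    obtain ⟨y, hy, hP, hyz⟩ := hcov _ hzV
    rw [mem_ball_zero_iff] at hz
    rw [key z y hz hy.le hP hyz.symm, hy] at hz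
    exact lt_irrefl _ hz
  refine ⟨hmaps, hinj, ?_⟩
  have hopen : IsOpen (f '' ball 0 1) := by
    have hd : DifferentiableOn ℂ f (ball 0 1) := fun z hz =>
      (differentiableAt_div_slitProd ha hw ρ (mem_ball_zero_iff.1 hz)).differentiableWithinAt
    rcases (hd.analyticOnNhd isOpen_ball).is_constant_or_isOpen
      (convex_ball (0 : ℂ) 1).isPreconnected with ⟨c, hc⟩ | h
    · have h1 : (0 : ℂ) ∈ ball (0 : ℂ) 1 := by simp
      have h2 : (1 / 2 : ℂ) ∈ ball (0 : ℂ) 1 := by rw [mem_ball_zero_iff]; norm_num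
      have := hinj h1 h2 ((hc 0 h1).trans (hc _ h2).symm)
      norm_num at this
    · exact h _ subset_rfl isOpen_ball
  -- The image is open, contains 0 and is relatively closed in V, because limit values attained on
  -- the circle lie outside V.
  refine hV.subset_of_closure_inter_subset hopen ⟨0, h0, 0, by simp, by simp [hf]⟩ ?_
  rintro v ⟨hv, hvV⟩
  obtain ⟨z, hz, hP, rfl⟩ := exists_eq_of_mem_closure_image ha hw hρ hv
  refine ⟨z, ?_, rfl⟩
  rw [mem_ball_zero_iff]
  exact hz.lt_of_ne fun h => hbd z h hP hvV

end SlitProd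

/-! ### Schwarz lemma and uniqueness of the normalized map. -/

section Uniqueness

open Complex Metric Set Filter Topology

theorem differentiableOn_invFunOn_image {f : ℂ → ℂ} {s : Set ℂ} (hs : IsOpen s)
    (hf : DifferentiableOn ℂ f s) (hinj : InjOn f s) (hd : ∀ z ∈ s, deriv f z ≠ 0) :
    DifferentiableOn ℂ (Function.invFunOn f s) (f '' s) := by
  rintro _ ⟨z, hz, rfl⟩
  have h1 : HasStrictDerivAt f (deriv f z) z :=
    (hf.analyticOnNhd hs z hz).hasStrictDerivAt
  refine (h1.to_local_left_inverse (hd z hz) ?_).hasDerivAt.differentiableAt.differentiableWithinAt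
  filter_upwards [hs.mem_nhds hz] with x hx
  exact hinj.leftInvOn_invFunOn hx

/-- A holomorphic bijection of the unit disk onto itself that fixes `0` has derivative of modulus
at least one at `0`, provided this derivative does not vanish. -/
theorem one_le_norm_deriv_of_bijOn_ball {h : ℂ → ℂ} (hd : DifferentiableOn ℂ h (ball 0 1))
    (hb : BijOn h (ball 0 1) (ball 0 1)) (h0 : h 0 = 0) (hne : deriv h 0 ≠ 0) :
    1 ≤ ‖deriv h 0‖ := by
  have hslope : DifferentiableOn ℂ (dslope h 0) (ball 0 1) :=
    (differentiableOn_dslope (ball_mem_nhds 0 one_pos)).2 hd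
  have hslope_ne : ∀ z ∈ ball (0 : ℂ) 1, dslope h 0 z ≠ 0 := by
    intro z hz
    rcases eq_or_ne z 0 with rfl | hz0
    · rwa [dslope_same]
    · rw [dslope_of_ne _ hz0, slope_def_field, h0, sub_zero, sub_zero]
      refine div_ne_zero (fun hh => hz0 (hb.injOn hz (by simp) ?_)) hz0
      rw [hh, h0]
  have hopen : ∀ s ⊆ ball (0 : ℂ) 1, IsOpen s → IsOpen (h '' s) := by
    rcases (hd.analyticOnNhd isOpen_ball).is_constant_or_isOpen
      (convex_ball (0 : ℂ) 1).isPreconnected with ⟨c, hc⟩ | h'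
    · have h1 : (0 : ℂ) ∈ ball (0 : ℂ) 1 := by simp
      have h2 : (1 / 2 : ℂ) ∈ ball (0 : ℂ) 1 := by rw [mem_ball_zero_iff]; norm_num
      have := hb.injOn h1 h2 ((hc 0 h1).trans (hc _ h2).symm)
      norm_num at this
    · exact h'
  refine le_of_forall_lt fun c hc => lt_of_not_ge fun hle => ?_
  obtain ⟨s, hcs, hs1⟩ := exists_between hc
  have hs0 : 0 < s := (norm_pos_iff.2 hne).trans_le (hle.trans hcs.le)
  -- The compact disk of radius s is covered by the increasing open images of smaller disks, so one
  -- of them suffices. By injectivity, |h| > s on the circle of radius r.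
  obtain ⟨r, hr⟩ : ∃ r : Ioo (0 : ℝ) 1, closedBall (0 : ℂ) s ⊆ h '' ball 0 r := by
    have : Nonempty (Ioo (0 : ℝ) 1) := ⟨⟨1 / 2, by norm_num, by norm_num⟩⟩
    refine (isCompact_closedBall (0 : ℂ) s).elim_directed_cover
      (fun r : Ioo (0 : ℝ) 1 => h '' ball 0 r)
      (fun r => hopen _ (ball_subset_ball r.2.2.le) isOpen_ball) ?_ ?_
    · intro v hv
      obtain ⟨z, hz, rfl⟩ := hb.surjOn (closedBall_subset_ball hs1 hv)
      rw [mem_ball_zero_iff] at hz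
      obtain ⟨r, hzr, hr1⟩ := exists_between hz
      exact mem_iUnion.2 ⟨⟨r, (norm_nonneg z).trans_lt hzr, hr1⟩, z, mem_ball_zero_iff.2 hzr, rfl⟩
    · exact directed_of_isDirected_le fun r r' hrr' => image_mono (ball_subset_ball hrr')
  obtain ⟨r, hr0, hr1⟩ := r
  have hsub : closedBall (0 : ℂ) r ⊆ ball 0 1 := closedBall_subset_ball hr1
  -- Maximum modulus for z / h(z), with the value 1 / h'(0) at the origin.
  have hbound : ‖(dslope h 0 0)⁻¹‖ ≤ r / s := by
    refine norm_le_of_forall_mem_frontier_norm_le (f := fun z => (dslope h 0 z)⁻¹)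
      (U := ball (0 : ℂ) r) isBounded_ball ?_ ?_ (subset_closure (by simpa using hr0))
    · refine DifferentiableOn.diffContOnCl ?_
      rw [closure_ball _ hr0.ne']
      exact (hslope.mono hsub).inv fun z hz => hslope_ne z (hsub hz)
    · intro z hz
      rw [frontier_ball _ hr0.ne', mem_sphere_zero_iff_norm] at hz
      have hz0 : z ≠ 0 := norm_pos_iff.1 (hz ▸ hr0)
      have hz1 : z ∈ ball (0 : ℂ) 1 := by rw [mem_ball_zero_iff, hz]; exact hr1
      have hhz : s < ‖h z‖ := by
        by_contra hcon
        obtain ⟨y, hy, hyz⟩ := hr (mem_closedBall_zero_iff.2 (not_lt.1 hcon))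
        have := hb.injOn (ball_subset_ball hr1.le hy) hz1 hyz
        rw [this, mem_ball_zero_iff, hz] at hy
        exact lt_irrefl _ hy
      rw [dslope_of_ne _ hz0, slope_def_field, h0, sub_zero, sub_zero, inv_div, norm_div, hz]
      exact div_le_div_of_nonneg_left hr0.le hs0 hhz.le
  rw [dslope_same, norm_inv] at hbound
  have hpos : 0 < ‖deriv h 0‖ := norm_pos_iff.2 hne
  have h1 : r / s < 1 / s := div_lt_div_of_pos_right hr1 hs0
  have h2 : ‖deriv h 0‖⁻¹ < s⁻¹ := by
    rw [← one_div s]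
    exact hbound.trans_lt h1
  have h3 := (inv_lt_inv₀ hpos hs0).1 h2
  linarith

/-- Uniqueness of the normalized conformal isomorphism. -/
theorem IsNormalizedRiemannMap.eqOn {f g : ℂ → ℂ} {V : Set ℂ} (hf : IsNormalizedRiemannMap f V)
    (hg : IsNormalizedRiemannMap g V) (hfd : ∀ z ∈ ball (0 : ℂ) 1, deriv f z ≠ 0) :
    EqOn g f (ball 0 1) := by
  set k := Function.invFunOn f (ball (0 : ℂ) 1)
  have hV : f '' ball 0 1 = V := hf.bijOn.image_eq
  have hk : DifferentiableOn ℂ k V :=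
    hV ▸ differentiableOn_invFunOn_image isOpen_ball hf.differentiableOn hf.bijOn.injOn hfd
  have hkf : ∀ v ∈ V, f (k v) = v := fun v hv => hf.bijOn.surjOn.rightInvOn_invFunOn hv
  have hkb : BijOn k V (ball 0 1) :=
    hf.bijOn.symm ⟨hf.bijOn.surjOn.rightInvOn_invFunOn, hf.bijOn.injOn.leftInvOn_invFunOn⟩
  have hd : DifferentiableOn ℂ (k ∘ g) (ball 0 1) :=
    hk.comp hg.differentiableOn hg.bijOn.mapsTo
  have hb : BijOn (k ∘ g) (ball 0 1) (ball 0 1) := hkb.comp hg.bijOn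
  have hm : (0 : ℂ) ∈ ball (0 : ℂ) 1 := by simp
  have hfh : ∀ z ∈ ball (0 : ℂ) 1, f ((k ∘ g) z) = g z := fun z hz =>
    hkf _ (hg.bijOn.mapsTo hz)
  have h0 : (k ∘ g) 0 = 0 :=
    hf.bijOn.injOn (hb.mapsTo hm) hm (by rw [hfh 0 hm, hg.map_zero, hf.map_zero])
  have hnhds : ball (0 : ℂ) 1 ∈ 𝓝 (0 : ℂ) := ball_mem_nhds 0 one_pos
  have hderiv : deriv g 0 = deriv f 0 * deriv (k ∘ g) 0 := by
    have h1 : HasDerivAt (k ∘ g) (deriv (k ∘ g) 0) 0 := (hd.differentiableAt hnhds).hasDerivAt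
    have h2 : HasDerivAt f (deriv f 0) ((k ∘ g) 0) := by
      rw [h0]
      exact (hf.differentiableOn.differentiableAt hnhds).hasDerivAt
    refine ((h2.comp 0 h1).congr_of_eventuallyEq ?_).deriv
    filter_upwards [hnhds] with z hz
    exact (hfh z hz).symm
  have hfre : ((deriv f 0).re : ℂ) = deriv f 0 := Complex.ext rfl (by simp [hf.deriv_im_zero])
  have hgre : ((deriv g 0).re : ℂ) = deriv g 0 := Complex.ext rfl (by simp [hg.deriv_im_zero])
  -- The normalizations make this derivative a positive real, so modulus 1 will force it to equal 1
  -- and exclude rotations.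
  have hquot : deriv (k ∘ g) 0 = ((deriv g 0).re / (deriv f 0).re : ℝ) := by
    rw [ofReal_div, hfre, hgre, hderiv, mul_div_cancel_left₀ _ (hfd 0 hm)]
  have hpos : 0 < (deriv g 0).re / (deriv f 0).re := div_pos hg.deriv_re_pos hf.deriv_re_pos
  have hne : deriv (k ∘ g) 0 ≠ 0 := by
    rw [hquot]
    exact_mod_cast hpos.ne'
  have hmaps : MapsTo (k ∘ g) (ball 0 1) (closedBall ((k ∘ g) 0) 1) := by
    rw [h0]
    exact fun z hz => ball_subset_closedBall (hb.mapsTo hz)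
  have hnorm : ‖deriv (k ∘ g) 0‖ = 1 :=
    le_antisymm (norm_deriv_le_one_of_mapsTo_ball hd hmaps one_pos)
      (one_le_norm_deriv_of_bijOn_ball hd hb h0 hne)
  have hone : deriv (k ∘ g) 0 = 1 := by
    rw [hquot, norm_real, Real.norm_of_nonneg hpos.le] at hnorm
    rw [hquot, hnorm, ofReal_one]
  intro z hz
  have h3 := affine_of_mapsTo_ball_of_norm_dslope_eq_div hd hmaps hm
    (by rw [dslope_same, hnorm, div_one]) hz
  simp only [h0, dslope_same, hone, sub_zero, smul_eq_mul, mul_one, zero_add] at h3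
  rw [← hfh z hz, h3]

/-- Whichever map the choice operator picks, uniqueness makes it agree with f near 0. -/
theorem conformalRadius_eq_re_deriv {f : ℂ → ℂ} {V : Set ℂ} (hf : IsNormalizedRiemannMap f V)
    (hfd : ∀ z ∈ ball (0 : ℂ) 1, deriv f z ≠ 0) : conformalRadius V = (deriv f 0).re := by
  have hg : IsNormalizedRiemannMap
      (Classical.epsilon fun f : ℂ → ℂ => IsNormalizedRiemannMap f V) V :=
    Classical.epsilon_spec (p := fun f : ℂ → ℂ => IsNormalizedRiemannMap f V) ⟨f, hf⟩
  unfold conformalRadius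
  rw [((hf.eqOn hg hfd).eventuallyEq_of_mem (ball_mem_nhds 0 one_pos)).deriv_eq]

end Uniqueness

/-! ### The inverse function x(y) and the modulus on the unit circle. -/

section RealFunction

open Set

theorem slitY_strictAntiOn {γ : ℝ} (hγ : 0 < γ) : StrictAntiOn (slitY γ) (Icc 0 1) := by
  intro x hx y hy hxy
  have h1 : (1 - y) ^ γ < (1 - x) ^ γ :=
    Real.rpow_lt_rpow (by linarith [hy.2]) (by linarith) hγ
  have h2 : 0 ≤ (1 - y) ^ γ := Real.rpow_nonneg (by linarith [hy.2]) _
  unfold slitY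
  rw [div_lt_div_iff₀ (by linarith [hy.1]) (by linarith [hx.1])]
  nlinarith [hx.1, hy.1]

theorem slitY_zero {γ : ℝ} : slitY γ 0 = 1 := by simp [slitY]

theorem slitY_one {γ : ℝ} (hγ : 0 < γ) : slitY γ 1 = 0 := by simp [slitY, Real.zero_rpow hγ.ne']

theorem slitY_bijOn {γ : ℝ} (hγ : 0 < γ) : BijOn (slitY γ) (Icc 0 1) (Icc 0 1) := by
  have hanti := slitY_strictAntiOn hγ
  refine ⟨fun x hx => ⟨?_, ?_⟩, hanti.injOn, ?_⟩
  · rw [← slitY_one hγ]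
    exact hanti.antitoneOn hx (by simp) hx.2
  · rw [← slitY_zero (γ := γ)]
    exact hanti.antitoneOn (by simp) hx hx.1
  · have hc : ContinuousOn (slitY γ) (Icc 0 1) := by
      unfold slitY
      refine ContinuousOn.div ?_ (by fun_prop) fun x hx => by linarith [hx.1]
      exact ContinuousOn.rpow_const (by fun_prop) fun x _ => Or.inr hγ.le
    have := intermediate_value_Icc' zero_le_one hc
    rwa [slitY_zero, slitY_one hγ] at this

theorem slitValue_mem_Ioo {γ : ℝ} (h0 : 0 < γ) (h1 : γ < 1) : slitValue γ ∈ Ioo (0 : ℝ) 1 := by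
  have h2 : (0 : ℝ) < 2 ^ (γ - 1) := by positivity
  have h3 : 0 < γ ^ γ := Real.rpow_pos_of_pos h0 _
  have h4 : 0 < (1 - γ) ^ (1 - γ) := Real.rpow_pos_of_pos (by linarith) _
  have h5 : (2 : ℝ) ^ (γ - 1) < 1 := Real.rpow_lt_one_of_one_lt_of_neg (by norm_num) (by linarith)
  have h6 : γ ^ γ < 1 := Real.rpow_lt_one h0.le h1 h0
  have h7 : (1 - γ) ^ (1 - γ) < 1 := Real.rpow_lt_one (by linarith) (by linarith) (by linarith)
  refine ⟨by unfold slitValue; positivity, ?_⟩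
  unfold slitValue
  exact mul_lt_one_of_nonneg_of_lt_one_left (by positivity)
    (mul_lt_one_of_nonneg_of_lt_one_left h2.le h5 h6.le) h7.le

theorem slitX_slitValue {γ : ℝ} (h0 : 0 < γ) (h1 : γ < 1) :
    slitX γ (slitValue γ) ∈ Ioo (0 : ℝ) 1 ∧ slitY γ (slitX γ (slitValue γ)) = slitValue γ := by
  have hv := slitValue_mem_Ioo h0 h1
  have hs := (slitY_bijOn h0).surjOn
  have hmem : slitX γ (slitValue γ) ∈ Icc (0 : ℝ) 1 := hs.mapsTo_invFunOn (Ioo_subset_Icc_self hv)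
  have heq : slitY γ (slitX γ (slitValue γ)) = slitValue γ :=
    hs.rightInvOn_invFunOn (Ioo_subset_Icc_self hv)
  refine ⟨⟨hmem.1.lt_of_ne fun h => ?_, hmem.2.lt_of_ne fun h => ?_⟩, heq⟩
  · rw [← h, slitY_zero] at heq
    exact hv.2.ne heq.symm
  · rw [h, slitY_one h0] at heq
    exact hv.1.ne heq

/-- The modulus of `(1 - z / e^{it})^γ (1 + z)^(2 - 2γ) (1 - z / e^{-it})^γ` at a point `z` of the
unit circle with real part `c`, where `x = cos t`. -/
noncomputable def slitModulus (γ x c : ℝ) : ℝ := (2 * |c - x|) ^ γ * (2 * (1 + c)) ^ (1 - γ)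

/-- The value `2 (1 + x) γ^γ (1 - γ)^(1 - γ)` of the conformal radius. -/
noncomputable def slitRadius (γ x : ℝ) : ℝ := 2 * (1 + x) * γ ^ γ * (1 - γ) ^ (1 - γ)

variable {γ x c : ℝ}

theorem slitRadius_pos (h0 : 0 < γ) (h1 : γ < 1) (hx : -1 < x) : 0 < slitRadius γ x := by
  have h3 : 0 < γ ^ γ := Real.rpow_pos_of_pos h0 _
  have h4 : 0 < (1 - γ) ^ (1 - γ) := Real.rpow_pos_of_pos (by linarith) _
  have h5 : 0 < 1 + x := by linarith
  unfold slitRadius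
  positivity

/-- The only place where the explicit value of y(x) is used: it makes the maximum at c = 1 agree
with the one left of x. -/
theorem slitModulus_one (hx : x ∈ Ioo (0 : ℝ) 1) (hxy : slitY γ x = slitValue γ) :
    slitModulus γ x 1 = slitRadius γ x := by
  have h2 : (1 - x) ^ γ = slitValue γ * (1 + x) := by
    rw [← hxy, slitY, div_mul_cancel₀ _ (by linarith [hx.1])]
  have h3 : (2 : ℝ) ^ γ * ((2 * (1 + 1)) ^ (1 - γ) * 2 ^ (γ - 1)) = 2 := by
    have : (2 * (1 + 1) : ℝ) = 2 ^ (2 : ℝ) := by norm_num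
    rw [this, ← Real.rpow_mul (by norm_num), ← Real.rpow_add (by norm_num),
      ← Real.rpow_add (by norm_num)]
    ring_nf
    exact Real.rpow_one 2
  unfold slitModulus slitRadius
  rw [abs_of_pos (by linarith [hx.2]), Real.mul_rpow (by norm_num) (by linarith [hx.2]), h2,
    slitValue]
  linear_combination (γ ^ γ * (1 - γ) ^ (1 - γ) * (1 + x)) * h3

/-- This c is the equality case of AM-GM: (x - c)/γ = (1 + c)/(1 - γ). -/
theorem slitModulus_critical (h0 : 0 < γ) (h1 : γ < 1) (hx : -1 < x) :
    slitModulus γ x ((1 - γ) * x - γ) = slitRadius γ x := by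
  have hx' : 0 < 1 + x := by linarith
  have h1' : 0 < 1 - γ := by linarith
  have e1 : 2 * |(1 - γ) * x - γ - x| = (2 * (1 + x)) * γ := by
    rw [abs_of_neg (by nlinarith)]
    ring
  have e2 : 2 * (1 + ((1 - γ) * x - γ)) = (2 * (1 + x)) * (1 - γ) := by ring
  have e3 : (2 * (1 + x)) ^ γ * (2 * (1 + x)) ^ (1 - γ) = 2 * (1 + x) := by
    rw [← Real.rpow_add (by positivity), add_sub_cancel, Real.rpow_one]
  unfold slitModulus slitRadius
  rw [e1, e2, Real.mul_rpow (by positivity) h0.le, Real.mul_rpow (by positivity) h1'.le]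
  linear_combination γ ^ γ * (1 - γ) ^ (1 - γ) * e3

theorem slitModulus_pos (hcx : c ≠ x) (hc : -1 < c) : 0 < slitModulus γ x c := by
  have h1 : 0 < |c - x| := abs_pos.2 (sub_ne_zero.2 hcx)
  have h2 : 0 < 1 + c := by linarith
  exact mul_pos (Real.rpow_pos_of_pos (by positivity) _) (Real.rpow_pos_of_pos (by positivity) _)

theorem slitModulus_self (h0 : 0 < γ) : slitModulus γ x x = 0 := by
  simp [slitModulus, Real.zero_rpow h0.ne']

theorem continuous_slitModulus (h0 : 0 < γ) (h1 : γ < 1) : Continuous (slitModulus γ x) := by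
  unfold slitModulus
  exact (Continuous.rpow_const (by fun_prop) fun _ => Or.inr h0.le).mul
    (Continuous.rpow_const (by fun_prop) fun _ => Or.inr (by linarith))

/-- Right of x both factors increase with c, so c = 1 is extremal; left of x the bound is weighted
AM-GM. -/
theorem slitModulus_le (h0 : 0 < γ) (h1 : γ < 1) (hx : x ∈ Ioo (0 : ℝ) 1)
    (hxy : slitY γ x = slitValue γ) (hc : c ∈ Icc (-1 : ℝ) 1) :
    slitModulus γ x c ≤ slitRadius γ x := by
  have h1' : 0 < 1 - γ := by linarith
  have hc1 : 0 ≤ 1 + c := by linarith [hc.1]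
  rcases le_total x c with h | h
  · rw [← slitModulus_one hx hxy]
    unfold slitModulus
    rw [abs_of_nonneg (by linarith), abs_of_nonneg (by linarith [hc.2])]
    refine mul_le_mul (Real.rpow_le_rpow (by linarith) (by linarith [hc.2]) h0.le)
      (Real.rpow_le_rpow (by linarith) (by linarith [hc.2]) h1'.le)
      (Real.rpow_nonneg (by linarith) _) (Real.rpow_nonneg (by linarith [hc.2]) _)
  · have hd : 0 ≤ x - c := by linarith
    -- Dividing by the weights makes the arithmetic mean 2(1 + x), independent of c.
    have key := Real.geom_mean_le_arith_mean2_weighted h0.le h1'.le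
      (p₁ := 2 * (x - c) / γ) (p₂ := 2 * (1 + c) / (1 - γ)) (by positivity) (by positivity)
      (by ring)
    have e : γ * (2 * (x - c) / γ) + (1 - γ) * (2 * (1 + c) / (1 - γ)) = 2 * (1 + x) := by
      field_simp
      ring
    have hg : 0 < γ ^ γ := Real.rpow_pos_of_pos h0 _
    have hg' : 0 < (1 - γ) ^ (1 - γ) := Real.rpow_pos_of_pos h1' _
    rw [e, Real.div_rpow (by positivity) h0.le, Real.div_rpow (by positivity) h1'.le,
      div_mul_div_comm, div_le_iff₀ (by positivity)] at key
    unfold slitModulus slitRadius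
    rw [abs_of_nonpos (by linarith), neg_sub]
    linarith

theorem exists_slitModulus_eq_right (h0 : 0 < γ) (h1 : γ < 1) (hx : x ∈ Ioo (0 : ℝ) 1)
    (hxy : slitY γ x = slitValue γ) {q : ℝ} (hq0 : 0 < q) (hq : q ≤ slitRadius γ x) :
    ∃ c, x < c ∧ c ≤ 1 ∧ slitModulus γ x c = q := by
  have h := intermediate_value_Icc hx.2.le (continuous_slitModulus (x := x) h0 h1).continuousOn
  rw [slitModulus_self h0, slitModulus_one hx hxy] at h
  obtain ⟨c, hc, rfl⟩ := h ⟨hq0.le, hq⟩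
  refine ⟨c, hc.1.lt_of_ne ?_, hc.2, rfl⟩
  rintro rfl
  rw [slitModulus_self h0] at hq0
  exact lt_irrefl _ hq0

theorem exists_slitModulus_eq_left (h0 : 0 < γ) (h1 : γ < 1) (hx : x ∈ Ioo (0 : ℝ) 1)
    {q : ℝ} (hq0 : 0 < q) (hq : q ≤ slitRadius γ x) :
    ∃ c, -1 < c ∧ c < x ∧ slitModulus γ x c = q := by
  have hle : (1 - γ) * x - γ ≤ x := by nlinarith [hx.1]
  have h := intermediate_value_Icc' hle (continuous_slitModulus (x := x) h0 h1).continuousOn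
  rw [slitModulus_self h0, slitModulus_critical h0 h1 (by linarith [hx.1])] at h
  obtain ⟨c, hc, rfl⟩ := h ⟨hq0.le, hq⟩
  refine ⟨c, ?_, hc.2.lt_of_ne ?_, rfl⟩
  · nlinarith [hc.1, hx.1]
  · rintro rfl
    rw [slitModulus_self h0] at hq0
    exact lt_irrefl _ hq0

end RealFunction

/-! ### The three-factor product on the unit circle, for θ = 0. -/

section Boundary

open Complex Set

variable {γ t : ℝ} {u : ℂ}

theorem mul_conj_of_norm_one (hu : ‖u‖ = 1) : u.re ^ 2 + u.im ^ 2 = 1 := by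
  have := normSq_eq_norm_sq u
  rw [hu, normSq_apply] at this
  linarith

/-- On the circle u² + 1 = 2 (Re u) u, so the product of conjugate factors is a real multiple of u.
This is what fixes the argument on each arc. -/
theorem one_sub_exp_mul_mul (hu : ‖u‖ = 1) (t : ℝ) :
    (1 - exp (-(t * I)) * u) * (1 - exp (t * I) * u) =
      ((2 * (u.re - Real.cos t) : ℝ) : ℂ) * u := by
  have h1 : exp (-(t * I)) * exp (t * I) = 1 := by rw [← exp_add]; simp
  have h2 : exp (-(t * I)) + exp (t * I) = 2 * Complex.cos t := by
    rw [Complex.cos, neg_mul]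
    ring
  have h3 : u * u + 1 = 2 * u.re * u := by
    have := mul_conj_of_norm_one hu
    apply Complex.ext
    · simp
      linarith
    · simp
      ring
  push_cast
  linear_combination u ^ 2 * h1 - u * h2 + h3

theorem one_add_sq_eq (hu : ‖u‖ = 1) : (1 + u) ^ 2 = ((2 * (1 + u.re) : ℝ) : ℂ) * u := by
  have h3 : u * u + 1 = 2 * u.re * u := by
    have := mul_conj_of_norm_one hu
    apply Complex.ext
    · simp
      linarith
    · simp
      ring
  push_cast
  linear_combination h3

theorem log_mul_of_re_pos {p q : ℂ} (hp : 0 < p.re) (hq : 0 < q.re) :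
    log (p * q) = log p + log q := by
  have h1 := abs_lt.1 (abs_arg_lt_pi_div_two_iff.2 (Or.inl hp))
  have h2 := abs_lt.1 (abs_arg_lt_pi_div_two_iff.2 (Or.inl hq))
  have hp0 : p ≠ 0 := by rintro rfl; simp at hp
  have hq0 : q ≠ 0 := by rintro rfl; simp at hq
  exact (log_mul_eq_add_log_iff hp0 hq0).2 ⟨by linarith [h1.1, h2.1], by linarith [h1.2, h2.2]⟩

/-- The product `(1 - u / e^{it})^γ (1 + u)^(2 - 2γ) (1 - u / e^{-it})^γ`. -/
noncomputable def threeSlitProd (γ t : ℝ) (u : ℂ) : ℂ :=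
  (1 - exp (-(t * I)) * u) ^ (γ : ℂ) * (1 + u) ^ ((2 - 2 * γ : ℝ) : ℂ) *
    (1 - exp (t * I) * u) ^ (γ : ℂ)

theorem threeSlitProd_ne_zero_iff (h0 : 0 < γ) (h1 : γ < 1) (hu : ‖u‖ = 1) :
    threeSlitProd γ t u ≠ 0 ↔ u.re ≠ Real.cos t ∧ u.re ≠ -1 := by
  have hu0 : u ≠ 0 := norm_ne_zero_iff.1 (by rw [hu]; exact one_ne_zero)
  have e1 : u.re = Real.cos t ↔ 1 - exp (-(t * I)) * u = 0 ∨ 1 - exp (t * I) * u = 0 := by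
    rw [← mul_eq_zero, one_sub_exp_mul_mul hu, mul_eq_zero, ofReal_eq_zero]
    simp [hu0, sub_eq_zero]
  have e2 : u.re = -1 ↔ 1 + u = 0 := by
    rw [← pow_eq_zero_iff two_ne_zero, one_add_sq_eq hu, mul_eq_zero, ofReal_eq_zero]
    simp only [hu0, or_false, mul_eq_zero, OfNat.ofNat_ne_zero, false_or]
    constructor <;> intro h <;> linarith
  have h2 : 2 - 2 * γ ≠ 0 := by linarith
  rw [threeSlitProd, ne_eq, ne_eq, ne_eq, e1, e2]
  simp only [mul_eq_zero, cpow_eq_zero_iff, ofReal_eq_zero, h0.ne', h2, ne_eq, not_false_eq_true,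
    and_true]
  tauto

/-- All nonzero factors lie in the open right half-plane, so principal logarithms add in pairs
without a 2πi correction. -/
theorem threeSlitProd_eq_exp (h0 : 0 < γ) (h1 : γ < 1) (hu : ‖u‖ = 1)
    (hne : threeSlitProd γ t u ≠ 0) :
    threeSlitProd γ t u = exp (γ * log (((2 * (u.re - Real.cos t) : ℝ) : ℂ) * u) +
      (1 - γ) * log (((2 * (1 + u.re) : ℝ) : ℂ) * u)) := by
  have hn : ∀ s : ℝ, ‖exp (s * I)‖ = 1 := norm_exp_ofReal_mul_I
  have hn' : ‖exp (-(t * I))‖ = 1 := by simpa using hn (-t)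
  have hne' := hne
  rw [threeSlitProd] at hne'
  obtain ⟨⟨hA, hC⟩, hB⟩ : ((1 - exp (-(t * I)) * u ≠ 0) ∧ 1 + u ≠ 0) ∧ 1 - exp (t * I) * u ≠ 0 := by
    have h2 : 2 - 2 * γ ≠ 0 := by linarith
    simpa only [ne_eq, mul_eq_zero, cpow_eq_zero_iff, ofReal_eq_zero, h0.ne', h2, not_false_eq_true,
      and_true, not_or] using hne'
  have hA' := one_sub_mul_re_pos_of_ne hn' hu.le hA
  have hB' := one_sub_mul_re_pos_of_ne (hn t) hu.le hB
  have hC' : 0 < (1 + u).re := by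
    have := one_sub_mul_re_pos_of_ne (a := -1) (by simp) hu.le (by simpa using hC)
    simpa using this
  rw [← one_sub_exp_mul_mul hu, ← one_add_sq_eq hu, sq, log_mul_of_re_pos hA' hB',
    log_mul_of_re_pos hC' hC', threeSlitProd, cpow_def_of_ne_zero hA, cpow_def_of_ne_zero hB,
    cpow_def_of_ne_zero hC, ← exp_add, ← exp_add]
  congr 1
  push_cast
  ring

theorem slitModulus_eq_exp {x c : ℝ} (hcx : c ≠ x) (hc : -1 < c) :
    ((slitModulus γ x c : ℝ) : ℂ) =
      exp (γ * Real.log (2 * |c - x|) + (1 - γ) * Real.log (2 * (1 + c))) := by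
  have h1 : 0 < |c - x| := abs_pos.2 (sub_ne_zero.2 hcx)
  rw [slitModulus, Real.rpow_def_of_pos (by positivity), Real.rpow_def_of_pos (by linarith),
    ← Real.exp_add, ofReal_exp]
  push_cast
  congr 1
  ring

theorem threeSlitProd_eq_of_lt (h0 : 0 < γ) (h1 : γ < 1) (hu : ‖u‖ = 1) (hc : -1 < u.re)
    (hcx : Real.cos t < u.re) :
    threeSlitProd γ t u = u * (slitModulus γ (Real.cos t) u.re : ℝ) := by
  have hu0 : u ≠ 0 := norm_ne_zero_iff.1 (by rw [hu]; exact one_ne_zero)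
  rw [threeSlitProd_eq_exp h0 h1 hu ((threeSlitProd_ne_zero_iff h0 h1 hu).2 ⟨hcx.ne', hc.ne'⟩),
    slitModulus_eq_exp hcx.ne' hc, log_ofReal_mul (by linarith) hu0,
    log_ofReal_mul (by linarith) hu0, abs_of_pos (by linarith)]
  nth_rewrite 5 [← exp_log hu0]
  rw [← exp_add]
  congr 1
  ring

/-- Left of cos t the real multiplier of u is negative. Its sign is moved onto u, and the jump k =
∓πi between log u and log(-u) produces the slit angle ±πγ. -/
theorem threeSlitProd_eq_of_gt (h0 : 0 < γ) (h1 : γ < 1) (hu : ‖u‖ = 1) (hc : -1 < u.re)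
    (hcx : u.re < Real.cos t) {k : ℂ} (hk : log (-u) = log u + k) :
    threeSlitProd γ t u = u * (slitModulus γ (Real.cos t) u.re : ℝ) * exp (γ * k) := by
  have hu0 : u ≠ 0 := norm_ne_zero_iff.1 (by rw [hu]; exact one_ne_zero)
  have e : ((2 * (u.re - Real.cos t) : ℝ) : ℂ) * u = ((2 * (Real.cos t - u.re) : ℝ) : ℂ) * (-u) := by
    push_cast
    ring
  rw [threeSlitProd_eq_exp h0 h1 hu ((threeSlitProd_ne_zero_iff h0 h1 hu).2 ⟨hcx.ne, hc.ne'⟩),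
    slitModulus_eq_exp hcx.ne hc, e, log_ofReal_mul (by linarith) (neg_ne_zero.2 hu0), hk,
    log_ofReal_mul (by linarith) hu0, abs_of_neg (by linarith), neg_sub]
  nth_rewrite 5 [← exp_log hu0]
  rw [← exp_add, ← exp_add]
  congr 1
  ring

theorem log_neg_of_im_pos (hu : 0 < u.im) : log (-u) = log u + -(Real.pi * I) := by
  rw [log, log, norm_neg, arg_neg_eq_arg_sub_pi_of_im_pos hu]
  push_cast
  ring

theorem log_neg_of_im_neg (hu : u.im < 0) : log (-u) = log u + Real.pi * I := by
  rw [log, log, norm_neg, arg_neg_eq_arg_add_pi_of_im_neg hu]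
  push_cast
  ring

end Boundary

/-! ### Assembly for the three-slit domain. -/

section ThreeSlits

open Complex Set Metric

/-- The reciprocals of the prevertices `e^{i(θ+t)}`, `e^{i(θ+π)}`, `e^{i(θ-t)}`. -/
noncomputable def threeSlitCoeff (θ t : ℝ) : Fin 3 → ℂ :=
  ![exp (-((θ + t : ℝ) * I)), exp (-((θ + Real.pi : ℝ) * I)), exp (-((θ - t : ℝ) * I))]

/-- The exponents `γ, 2 - 2γ, γ`. -/
def threeSlitWeight (γ : ℝ) : Fin 3 → ℝ := ![γ, 2 - 2 * γ, γ]

theorem norm_threeSlitCoeff (θ t : ℝ) (j : Fin 3) : ‖threeSlitCoeff θ t j‖ = 1 := by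
  have h : ∀ s : ℝ, ‖exp (-(s * I))‖ = 1 := fun s => by
    simpa using norm_exp_ofReal_mul_I (-s)
  fin_cases j
  · exact h _
  · exact h _
  · exact h _

theorem threeSlitWeight_pos {γ : ℝ} (h0 : 0 < γ) (h1 : γ < 1) (j : Fin 3) :
    0 < threeSlitWeight γ j := by
  fin_cases j
  · exact h0
  · change 0 < 2 - 2 * γ
    linarith
  · exact h0

theorem sum_threeSlitWeight (γ : ℝ) : ∑ j, threeSlitWeight γ j = 2 := by
  simp only [threeSlitWeight, Fin.sum_univ_three, Matrix.cons_val_zero, Matrix.cons_val_one,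
    Matrix.cons_val]
  ring

/-- Rotation by θ reduces everything to the prevertices e^(it), -1, e^(-it). -/
theorem slitProd_threeSlit (γ θ t : ℝ) (u : ℂ) :
    slitProd (threeSlitCoeff θ t) (threeSlitWeight γ) (exp (θ * I) * u) = threeSlitProd γ t u := by
  have e1 : exp (-((θ + t : ℝ) * I)) * (exp (θ * I) * u) = exp (-(t * I)) * u := by
    rw [← mul_assoc, ← exp_add]
    congr 2
    push_cast
    ring
  have e2 : exp (-((θ + Real.pi : ℝ) * I)) * (exp (θ * I) * u) = -u := by
    rw [← mul_assoc, ← exp_add]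
    have : -((θ + Real.pi : ℝ) * I) + θ * I = -(Real.pi * I) := by push_cast; ring
    rw [this, exp_neg, exp_pi_mul_I]
    norm_num
  have e3 : exp (-((θ - t : ℝ) * I)) * (exp (θ * I) * u) = exp (t * I) * u := by
    rw [← mul_assoc, ← exp_add]
    congr 2
    push_cast
    ring
  simp only [slitProd, Fin.prod_univ_three, threeSlitCoeff, threeSlitWeight, Matrix.cons_val_zero,
    Matrix.cons_val_one, Matrix.cons_val, e1, e2, e3, threeSlitProd,
    sub_neg_eq_add]

theorem zero_mem_slitDomain {m : ℕ} (φ : Fin m → ℝ) : (0 : ℂ) ∈ slitDomain φ := by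
  intro j r hr h
  have : (r : ℂ) ≠ 0 := by exact_mod_cast (by linarith : r ≠ 0)
  exact mul_ne_zero this (exp_ne_zero _) h.symm

/-- The domain is star-shaped about 0: if b v lies on a slit with 0 < b ≤ 1, then so does v. -/
theorem isPreconnected_slitDomain {m : ℕ} (φ : Fin m → ℝ) : IsPreconnected (slitDomain φ) := by
  have h0 := zero_mem_slitDomain φ
  have hstar : StarConvex ℝ 0 (slitDomain φ) := by
    rw [starConvex_zero_iff]
    intro v hv b hb0 hb1 j r hr h
    rcases hb0.lt_or_eq with hb | rfl
    · refine hv j (r / b) ((one_le_div hb).2 (hb1.trans hr)) ?_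
      have hb' : (b : ℂ) ≠ 0 := by exact_mod_cast hb.ne'
      rw [real_smul] at h
      push_cast
      rw [div_mul_eq_mul_div, ← h, mul_div_cancel_left₀ _ hb']
    · rw [zero_smul] at h
      exact h0 j r hr h
  exact (hstar.isPathConnected h0).isConnected.isPreconnected

theorem notMem_slitDomain_threeSlitAngles {γ θ : ℝ} {v : ℂ} :
    v ∉ slitDomain (threeSlitAngles γ θ) ↔ ∃ r : ℝ, 1 ≤ r ∧
      (v = r * exp (θ * I) ∨ v = r * (exp (θ * I) * exp (γ * (Real.pi * I))) ∨
        v = r * (exp (θ * I) * exp (-(γ * (Real.pi * I))))) := by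
  have e1 : exp (((θ + Real.pi * γ : ℝ) : ℂ) * I) = exp (θ * I) * exp (γ * (Real.pi * I)) := by
    rw [← exp_add]
    congr 1
    push_cast
    ring
  have e2 : exp (((θ + (2 * Real.pi - Real.pi * γ) : ℝ) : ℂ) * I) =
      exp (θ * I) * exp (-(γ * (Real.pi * I))) := by
    rw [← exp_add, exp_eq_exp_iff_exists_int]
    -- One full turn identifies the angle 2π - πγ with -πγ.
    refine ⟨1, ?_⟩
    push_cast
    ring
  rw [← e1, ← e2]
  simp only [slitDomain, mem_ofPred_eq, threeSlitAngles, not_forall, ne_eq, not_not, Fin.exists_fin_succ,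
    exists_prop]
  simp only [Matrix.cons_val_zero, Matrix.cons_val_succ, IsEmpty.exists_iff, or_false]
  simp only [← exists_or, and_or_left]

variable {γ t : ℝ}

theorem exists_norm_one_of_re {c : ℝ} (hc : c ∈ Icc (-1 : ℝ) 1) :
    ∃ u : ℂ, ‖u‖ = 1 ∧ u.re = c ∧ u.im = Real.sqrt (1 - c ^ 2) := by
  refine ⟨⟨c, Real.sqrt (1 - c ^ 2)⟩, ?_, rfl, rfl⟩
  have h : 0 ≤ 1 - c ^ 2 := by nlinarith [hc.1, hc.2]
  rw [← sq_eq_sq₀ (norm_nonneg _) zero_le_one, ← normSq_eq_norm_sq, normSq_apply,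
    Real.mul_self_sqrt h]
  ring

/-- The boundary values on the unit circle lie on the slits. -/
theorem threeSlit_boundary_notMem (h0 : 0 < γ) (h1 : γ < 1) (ht : Real.cos t ∈ Ioo (0 : ℝ) 1)
    (hxy : slitY γ (Real.cos t) = slitValue γ) (θ : ℝ) {z : ℂ} (hz : ‖z‖ = 1)
    (hP : slitProd (threeSlitCoeff θ t) (threeSlitWeight γ) z ≠ 0) :
    (slitRadius γ (Real.cos t) : ℂ) *
      (z / slitProd (threeSlitCoeff θ t) (threeSlitWeight γ) z) ∉
        slitDomain (threeSlitAngles γ θ) := by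
  obtain ⟨u, rfl⟩ : ∃ u, exp (θ * I) * u = z :=
    ⟨exp (-(θ * I)) * z, by rw [← mul_assoc, ← exp_add]; simp⟩
  have hu : ‖u‖ = 1 := by rwa [norm_mul, norm_exp_ofReal_mul_I, one_mul] at hz
  have hu0 : u ≠ 0 := norm_ne_zero_iff.1 (by rw [hu]; exact one_ne_zero)
  rw [slitProd_threeSlit] at hP ⊢
  obtain ⟨hx, hm⟩ := (threeSlitProd_ne_zero_iff h0 h1 hu).1 hP
  have hmem : u.re ∈ Icc (-1 : ℝ) 1 := abs_le.1 (hu ▸ abs_re_le_norm u)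
  have hc : -1 < u.re := hmem.1.lt_of_ne hm.symm
  have hq := slitModulus_pos (γ := γ) hx hc
  have hle := slitModulus_le h0 h1 ht hxy hmem
  have hq' : ((slitModulus γ (Real.cos t) u.re : ℝ) : ℂ) ≠ 0 := by exact_mod_cast hq.ne'
  refine notMem_slitDomain_threeSlitAngles.2
    ⟨slitRadius γ (Real.cos t) / slitModulus γ (Real.cos t) u.re, (one_le_div hq).2 hle, ?_⟩
  rw [ofReal_div]
  rcases lt_or_gt_of_ne hx with hlt | hgt
  -- A real u on the circle is ±1, which -1 < Re u < cos t < 1 excludes; the sign of Im u then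
  -- selects the slit.
  · have him : u.im ≠ 0 := by
      intro h
      have := mul_conj_of_norm_one hu
      rw [h] at this
      nlinarith [ht.2]
    rcases lt_or_gt_of_ne him with hi | hi
    · rw [threeSlitProd_eq_of_gt h0 h1 hu hc hlt (log_neg_of_im_neg hi), exp_neg]
      have := exp_ne_zero (γ * (Real.pi * I))
      right; right
      field_simp
    · rw [threeSlitProd_eq_of_gt h0 h1 hu hc hlt (log_neg_of_im_pos hi), mul_neg, exp_neg]
      have := exp_ne_zero (γ * (Real.pi * I))
      right; left
      field_simp
  · rw [threeSlitProd_eq_of_lt h0 h1 hu hc hgt]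
    left
    field_simp

/-- Every point of the slits is a boundary value on the unit circle. -/
theorem exists_threeSlit_boundary_eq (h0 : 0 < γ) (h1 : γ < 1) (ht : Real.cos t ∈ Ioo (0 : ℝ) 1)
    (hxy : slitY γ (Real.cos t) = slitValue γ) (θ : ℝ) {v : ℂ}
    (hv : v ∉ slitDomain (threeSlitAngles γ θ)) :
    ∃ z, ‖z‖ = 1 ∧ slitProd (threeSlitCoeff θ t) (threeSlitWeight γ) z ≠ 0 ∧
      (slitRadius γ (Real.cos t) : ℂ) *
        (z / slitProd (threeSlitCoeff θ t) (threeSlitWeight γ) z) = v := by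
  suffices h : ∃ u, ‖u‖ = 1 ∧ threeSlitProd γ t u ≠ 0 ∧
      (slitRadius γ (Real.cos t) : ℂ) * (exp (θ * I) * u / threeSlitProd γ t u) = v by
    obtain ⟨u, hu, hP, huv⟩ := h
    refine ⟨exp (θ * I) * u, by rw [norm_mul, norm_exp_ofReal_mul_I, hu, one_mul], ?_, ?_⟩
    · rwa [slitProd_threeSlit]
    · rwa [slitProd_threeSlit]
  obtain ⟨r, hr, hrv⟩ := notMem_slitDomain_threeSlitAngles.1 hv
  have hr0 : 0 < r := by linarith
  have hr0' : (r : ℂ) ≠ 0 := by exact_mod_cast hr0.ne'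
  have hρ : 0 < slitRadius γ (Real.cos t) := slitRadius_pos h0 h1 (by linarith [ht.1])
  have hρ' : (slitRadius γ (Real.cos t) : ℂ) ≠ 0 := by exact_mod_cast hρ.ne'
  have hq0 : 0 < slitRadius γ (Real.cos t) / r := div_pos hρ hr0
  have hq : slitRadius γ (Real.cos t) / r ≤ slitRadius γ (Real.cos t) := div_le_self hρ.le hr
  have hγ := exp_ne_zero (γ * (Real.pi * I))
  -- The same real part c serves both side slits: the point of the upper half circle goes to one,
  -- its conjugate to the other.
  have left_arc : ∃ c, -1 < c ∧ c < Real.cos t ∧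
      slitModulus γ (Real.cos t) c = slitRadius γ (Real.cos t) / r ∧ 0 < Real.sqrt (1 - c ^ 2) := by
    obtain ⟨c, hc, hcx, he⟩ := exists_slitModulus_eq_left h0 h1 ht hq0 hq
    exact ⟨c, hc, hcx, he, Real.sqrt_pos.2 (by nlinarith [ht.2])⟩
  rcases hrv with rfl | rfl | rfl
  · obtain ⟨c, hxc, hc1, he⟩ := exists_slitModulus_eq_right h0 h1 ht hxy hq0 hq
    have hc : -1 < c := by linarith [ht.1]
    obtain ⟨u, hu, rfl, -⟩ := exists_norm_one_of_re ⟨hc.le, hc1⟩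
    have hu0 : u ≠ 0 := norm_ne_zero_iff.1 (by rw [hu]; exact one_ne_zero)
    refine ⟨u, hu, (threeSlitProd_ne_zero_iff h0 h1 hu).2 ⟨hxc.ne', hc.ne'⟩, ?_⟩
    rw [threeSlitProd_eq_of_lt h0 h1 hu hc hxc, he]
    push_cast
    field_simp
  · obtain ⟨c, hc, hcx, he, hpos⟩ := left_arc
    obtain ⟨u, hu, rfl, him⟩ := exists_norm_one_of_re ⟨hc.le, (hcx.trans ht.2).le⟩
    have hu0 : u ≠ 0 := norm_ne_zero_iff.1 (by rw [hu]; exact one_ne_zero)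
    refine ⟨u, hu, (threeSlitProd_ne_zero_iff h0 h1 hu).2 ⟨hcx.ne, hc.ne'⟩, ?_⟩
    rw [threeSlitProd_eq_of_gt h0 h1 hu hc hcx (log_neg_of_im_pos (him ▸ hpos)), he, mul_neg,
      exp_neg]
    push_cast
    field_simp
  · obtain ⟨c, hc, hcx, he, hpos⟩ := left_arc
    obtain ⟨u', hu', rfl, him'⟩ := exists_norm_one_of_re ⟨hc.le, (hcx.trans ht.2).le⟩
    obtain ⟨u, rfl⟩ : ∃ u, (starRingEnd ℂ) u = u' := ⟨(starRingEnd ℂ) u', by simp⟩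
    rw [RCLike.norm_conj] at hu'
    rw [conj_re] at hc hcx he him' hpos
    rw [conj_im] at him'
    have hu0 : u ≠ 0 := norm_ne_zero_iff.1 (by rw [hu']; exact one_ne_zero)
    refine ⟨u, hu', (threeSlitProd_ne_zero_iff h0 h1 hu').2 ⟨hcx.ne, hc.ne'⟩, ?_⟩
    rw [threeSlitProd_eq_of_gt h0 h1 hu' hc hcx (log_neg_of_im_neg (by linarith)), he, exp_neg]
    push_cast
    field_simp

theorem isNormalizedRiemannMap_threeSlit (h0 : 0 < γ) (h1 : γ < 1)
    (ht : Real.cos t ∈ Ioo (0 : ℝ) 1) (hxy : slitY γ (Real.cos t) = slitValue γ) (θ : ℝ) :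
    IsNormalizedRiemannMap
      (fun z => (slitRadius γ (Real.cos t) : ℂ) *
        (z / slitProd (threeSlitCoeff θ t) (threeSlitWeight γ) z))
      (slitDomain (threeSlitAngles γ θ)) := by
  have ha := norm_threeSlitCoeff θ t
  have hw := threeSlitWeight_pos h0 h1
  have hρ : 0 < slitRadius γ (Real.cos t) := slitRadius_pos h0 h1 (by linarith [ht.1])
  refine ⟨fun z hz => (differentiableAt_div_slitProd ha hw _
    (mem_ball_zero_iff.1 hz)).differentiableWithinAt, ?_, by simp, ?_, ?_⟩
  · exact bijOn_div_slitProd ha hw (sum_threeSlitWeight γ) (by exact_mod_cast hρ.ne')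
      (isPreconnected_slitDomain _) (zero_mem_slitDomain _)
      (fun z hz hP => threeSlit_boundary_notMem h0 h1 ht hxy θ hz hP)
      (fun v hv => exists_threeSlit_boundary_eq h0 h1 ht hxy θ hv)
  · rwa [deriv_div_slitProd_zero ha, ofReal_re]
  · rw [deriv_div_slitProd_zero ha, ofReal_im]

end ThreeSlits

theorem mainTheorem5 (γ : ℝ) (hγ0 : 0 < γ) (hγ1 : γ < 1) :
    -- the inverse function `x(y)` is well defined, and it is evaluated at a point of its domain
    (StrictAntiOn (slitY γ) (Set.Icc 0 1) ∧
      Set.BijOn (slitY γ) (Set.Icc 0 1) (Set.Icc 0 1) ∧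
      slitValue γ ∈ Set.Ioo (0 : ℝ) 1) ∧
    ∀ x t : ℝ, x = slitX γ (slitValue γ) → t = Real.arccos x →
    ∀ θ : ℝ,
      -- the value of the conformal radius
      conformalRadius (slitDomain (threeSlitAngles γ θ)) =
          2 * (1 + x) * γ ^ γ * (1 - γ) ^ (1 - γ) ∧
      -- the normalized conformal isomorphism exists, is unique, and its accessory parameters
      -- are given by `x = cos t`
      ∃ f : ℂ → ℂ, IsNormalizedRiemannMap f (slitDomain (threeSlitAngles γ θ)) ∧
        (∀ g : ℂ → ℂ, IsNormalizedRiemannMap g (slitDomain (threeSlitAngles γ θ)) →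
          Set.EqOn g f (Metric.ball 0 1)) ∧
        ∀ z ∈ Metric.ball (0 : ℂ) 1,
          f z = (conformalRadius (slitDomain (threeSlitAngles γ θ)) : ℂ) * z *
            (1 - z / Complex.exp (((θ + t : ℝ) : ℂ) * Complex.I)) ^ (-(γ : ℂ)) *
            (1 - z / Complex.exp (((θ + Real.pi : ℝ) : ℂ) * Complex.I)) ^ (-(2 - 2 * (γ : ℂ))) *
            (1 - z / Complex.exp (((θ - t : ℝ) : ℂ) * Complex.I)) ^ (-(γ : ℂ)) := by
  refine ⟨⟨slitY_strictAntiOn hγ0, slitY_bijOn hγ0, slitValue_mem_Ioo hγ0 hγ1⟩, ?_⟩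
  intro x t hx ht θ
  obtain ⟨hmem, hxy⟩ := slitX_slitValue hγ0 hγ1
  rw [← hx] at hmem hxy
  have hcos : Real.cos t = x := by
    rw [ht, Real.cos_arccos (by linarith [hmem.1]) hmem.2.le]
  rw [← hcos] at hmem hxy
  have hmap := isNormalizedRiemannMap_threeSlit hγ0 hγ1 hmem hxy θ
  have ha := norm_threeSlitCoeff θ t
  have hρ : (slitRadius γ (Real.cos t) : ℂ) ≠ 0 := by
    exact_mod_cast (slitRadius_pos hγ0 hγ1 (by linarith [hmem.1])).ne'
  have hd : ∀ z ∈ Metric.ball (0 : ℂ) 1, deriv (fun z => (slitRadius γ (Real.cos t) : ℂ) *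
      (z / slitProd (threeSlitCoeff θ t) (threeSlitWeight γ) z)) z ≠ 0 := fun z hz =>
    deriv_div_slitProd_ne_zero ha (threeSlitWeight_pos hγ0 hγ1) (sum_threeSlitWeight γ) hρ
      (mem_ball_zero_iff.1 hz)
  have hrad : conformalRadius (slitDomain (threeSlitAngles γ θ)) = slitRadius γ (Real.cos t) := by
    rw [conformalRadius_eq_re_deriv hmap hd, deriv_div_slitProd_zero ha, Complex.ofReal_re]
  refine ⟨by rw [hrad, hcos, slitRadius], _, hmap, fun g hg => hmap.eqOn hg hd, fun z _ => ?_⟩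
  have e : ∀ s : ℝ, z / Complex.exp ((s : ℂ) * Complex.I) =
      Complex.exp (-((s : ℂ) * Complex.I)) * z := fun s => by
    rw [Complex.exp_neg, div_eq_inv_mul]
  simp only [hrad, e, Complex.cpow_neg, slitProd, Fin.prod_univ_three, threeSlitCoeff,
    threeSlitWeight, Matrix.cons_val_zero, Matrix.cons_val_one, Matrix.cons_val, div_eq_mul_inv,
    mul_inv]
  push_cast
  ring
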